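/- Let $R$ be a commutative ring and let $t,w,v,x\in R$ (for instance independent indeterminates, $R=\mathbb{Z}[t,w,v,x]$). Put $c_1=t$, $c_4=w$, $c_6=v$, $c_9=x$ and $c_n=1$ for every other $n\ge 1$, and let $$B(q)=1+q^2+q^3+q^4+q^5+q^6+q^7+q^8+q^{10}.$$ Then the infinite sum and the infinite product below converge in the ring $R[[q]]$ of formal power series (coefficientwise, with $R$ discrete), the infinite product is invertible in $R[[q]]$, and $$ \begin{aligned} 1&+q\,\frac{t}{1-tq}+q^4\,\frac{w+vq^2}{(1-tq)(1-wq^4)} +q^{9}\,\frac{x+q^2+v^2q^3+q^5}{(1-tq)(1-wq^4)(1-vq^6)}\\ &+q^{16}\,\frac{1+x^2q^2+q^3+xq^4+q^5+q^6+xq^7+q^8+q^{10}}{(1-tq)(1-wq^4)(1-vq^6)(1-xq^9)}\\ &+q^{25}\,\frac{B(q)}{(1-tq)(1-wq^4)(1-vq^6)(1-xq^9)(1-q^5)}\\ &+q^{36}\,\frac{B(q)}{(1-tq)(1-wq^4)(1-vq^6)(1-xq^9)(1-q^5)(1-q^6)}\\ &+q^{49}\,\frac{B(q)}{(1-tq)(1-wq^4)(1-vq^6)(1-xq^9)(1-q^5)(1-q^6)(1-q^7)}\\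 &+q^{64}\,\frac{B(q)}{(1-tq)(1-wq^4)(1-vq^6)(1-xq^9)(1-q^5)(1-q^6)(1-q^7)(1-q^8)}\\ &+\sum_{m=9}^{\infty}\frac{q^{m^2}}{\prod_{i=1}^{m}(1-c_iq^i)} \;=\;\frac{1}{\prod_{k=0}^{\infty}(1-c_{5k+1}q^{5k+1})(1-c_{5k+4}q^{5k+4})}. \end{aligned} $$ The right-hand side is $\dfrac{1}{(1-tq)(1-wq^4)(1-vq^6)(1-xq^9)(1-q^{11})(1-q^{14})\cdots}$, so for $t=w=v=x=1$ it is the product side of the first Rogers–Ramanujan identity. -/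

import Mathlib

open scoped PowerSeries PowerSeries.WithPiTopology

namespace WeightedRR

variable {R : Type*} [CommRing R]

/-- The formal fraction `f / g` of two power series over a commutative ring. It is the true
quotient whenever `g` is invertible, in particular whenever `g` has constant term `1`
(see `frac_mul_cancel`). -/
noncomputable def frac (f g : R⟦X⟧) : R⟦X⟧ := f * Ring.inverse g

theorem frac_mul_cancel (f g : R⟦X⟧) (hg : PowerSeries.constantCoeff g = 1) :
    frac f g * g = f := by
  have hu : IsUnit g := by
    rw [PowerSeries.isUnit_iff_constantCoeff, hg]
    exact isUnit_one
  rw [frac, mul_assoc, Ring.inverse_mul_cancel g hu, mul_one]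

/-- The weight of a part of size `n`: the parts `1`, `4`, `6`, `9` have the weights
`t`, `w`, `v`, `x`, and all other parts have weight `1`. -/
def weight (t w v x : R) : ℕ → R
  | 1 => t
  | 4 => w
  | 6 => v
  | 9 => x
  | _ => 1

/-- The denominator factor `1 - c_n q ^ n`, where `c_n` is the weight of a part of size `n`. -/
noncomputable def factor (t w v x : R) (n : ℕ) : R⟦X⟧ :=
  1 - PowerSeries.C (weight t w v x n) * PowerSeries.X ^ n

theorem constantCoeff_factor (t w v x : R) (n : ℕ) (hn : n ≠ 0) :
    PowerSeries.constantCoeff (factor t w v x n) = 1 := by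
  simp [factor, hn]

/-- The `m`-th tail term `q ^ (m ^ 2) / ∏_{i = 1}^{m} (1 - c_i q ^ i)`. -/
noncomputable def tailTerm (t w v x : R) (m : ℕ) : R⟦X⟧ :=
  frac (PowerSeries.X ^ (m ^ 2)) (∏ i ∈ Finset.Icc 1 m, factor t w v x i)

/-- The factor `(1 - c_{5k+1} q ^ (5k+1)) (1 - c_{5k+4} q ^ (5k+4))` of the product side. -/
noncomputable def pairFactor (t w v x : R) (k : ℕ) : R⟦X⟧ :=
  factor t w v x (5 * k + 1) * factor t w v x (5 * k + 4)

/-- The numerator `1 + q^2 + q^3 + q^4 + q^5 + q^6 + q^7 + q^8 + q^10`. -/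
noncomputable def commonNum (q : R⟦X⟧) : R⟦X⟧ :=
  1 + q ^ 2 + q ^ 3 + q ^ 4 + q ^ 5 + q ^ 6 + q ^ 7 + q ^ 8 + q ^ 10

/-- The terms `m = 0, …, 8` of the sum side, written in a power series `q` (below always the
variable) and constant power series `t w v x`. -/
noncomputable def headSum (q t w v x : R⟦X⟧) : R⟦X⟧ :=
  1
  + q * frac t (1 - t * q)
  + q ^ 4 * frac (w + v * q ^ 2) ((1 - t * q) * (1 - w * q ^ 4))
  + q ^ 9 * frac (x + q ^ 2 + v ^ 2 * q ^ 3 + q ^ 5)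
      ((1 - t * q) * (1 - w * q ^ 4) * (1 - v * q ^ 6))
  + q ^ 16 * frac (1 + x ^ 2 * q ^ 2 + q ^ 3 + x * q ^ 4 + q ^ 5 + q ^ 6 + x * q ^ 7
        + q ^ 8 + q ^ 10)
      ((1 - t * q) * (1 - w * q ^ 4) * (1 - v * q ^ 6) * (1 - x * q ^ 9))
  + q ^ 25 * frac (commonNum q)
      ((1 - t * q) * (1 - w * q ^ 4) * (1 - v * q ^ 6) * (1 - x * q ^ 9) * (1 - q ^ 5))
  + q ^ 36 * frac (commonNum q)
      ((1 - t * q) * (1 - w * q ^ 4) * (1 - v * q ^ 6) * (1 - x * q ^ 9) * (1 - q ^ 5)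
        * (1 - q ^ 6))
  + q ^ 49 * frac (commonNum q)
      ((1 - t * q) * (1 - w * q ^ 4) * (1 - v * q ^ 6) * (1 - x * q ^ 9) * (1 - q ^ 5)
        * (1 - q ^ 6) * (1 - q ^ 7))
  + q ^ 64 * frac (commonNum q)
      ((1 - t * q) * (1 - w * q ^ 4) * (1 - v * q ^ 6) * (1 - x * q ^ 9) * (1 - q ^ 5)
        * (1 - q ^ 6) * (1 - q ^ 7) * (1 - q ^ 8))

end WeightedRR

/-! The weights disappear after multiplication by D(t,w,v,x) = (1-tq)(1-wq^4)(1-vq^6)(1-xq^9): the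
sum side becomes D(1,1,1,1) ∑ q^(m^2)/(q;q)_m. The terms m ≥ 5 match one by one; the terms m ≤ 4
match only in total (`head_identity`). Since 1, 4, 6, 9 are all ±1 mod 5, the product side changes
by the same ratio, and the claim reduces to the first Rogers–Ramanujan identity.

That identity comes from Bailey's lemma, applied twice to the unit Bailey pair
(`sum_rogersRamanujan`). The resulting theta series is summed by the finite Jacobi triple product in
base q^5 (`sum_thetaPair`). Working modulo q^(N+1) turns the limits N → ∞ into exact equalities. -/

namespace WeightedRR

/-! ### Finite q-identities: Vandermonde, triple product, Bailey's lemma -/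

section Finite

open Finset

variable {A : Type*} [CommRing A]

/-- The finite `q`-Pochhammer symbol `(q; q)_n = ∏_{i = 1}^{n} (1 - q ^ i)`. -/
def qPoch (q : A) (n : ℕ) : A := ∏ i ∈ range n, (1 - q ^ (i + 1))

/-- The family `I` consists of the inverses of the `q`-Pochhammer symbols `(q; q)_n`. -/
def IsInvPoch (q : A) (I : ℕ → A) : Prop := ∀ n, qPoch q n * I n = 1

theorem qPoch_succ (q : A) (n : ℕ) : qPoch q (n + 1) = qPoch q n * (1 - q ^ (n + 1)) :=
  prod_range_succ _ _

namespace IsInvPoch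

variable {q : A} {I : ℕ → A}

theorem zero (h : IsInvPoch q I) : I 0 = 1 := by
  simpa [qPoch] using h 0

theorem succ (h : IsInvPoch q I) (n : ℕ) : I n = (1 - q ^ (n + 1)) * I (n + 1) := by
  have h1 := h n
  have h2 := h (n + 1)
  rw [qPoch_succ] at h2
  linear_combination (-I n) * h2 + (1 - q ^ (n + 1)) * I (n + 1) * h1

theorem isUnit_one_sub (h : IsInvPoch q I) (n : ℕ) : IsUnit (1 - q ^ (n + 1)) := by
  refine IsUnit.of_mul_eq_one (qPoch q n * I (n + 1)) ?_
  have h1 := h (n + 1)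
  rw [qPoch_succ] at h1
  linear_combination h1

/-- A q-Pascal rule under the sum: for r + u = s + 1, split 1 - q^(r+u) = q^r (1 - q^u) + (1 - q^r),
and let each factor lower one Pochhammer index. The primed version uses (1 - q^u) + q^u (1 - q^r).
-/
theorem sum_antidiagonal_succ (h : IsInvPoch q I) (f : ℕ → A) (s : ℕ) :
    (1 - q ^ (s + 1)) * ∑ p ∈ antidiagonal (s + 1), f p.1 * (I p.1 * I p.2)
      = ∑ p ∈ antidiagonal s, (f p.1 * q ^ p.1 + f (p.1 + 1)) * (I p.1 * I p.2) := by
  have key : ∀ p ∈ antidiagonal (s + 1), (1 - q ^ (s + 1)) * (f p.1 * (I p.1 * I p.2))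
      = f p.1 * q ^ p.1 * (I p.1 * ((1 - q ^ p.2) * I p.2))
        + f p.1 * ((1 - q ^ p.1) * I p.1 * I p.2) := by
    intro p hp
    rw [← mem_antidiagonal.1 hp, pow_add]
    ring
  rw [mul_sum, sum_congr rfl key, sum_add_distrib, Nat.sum_antidiagonal_succ',
    Nat.sum_antidiagonal_succ]
  simp only [← h.succ, pow_zero, sub_self, zero_mul, mul_zero, zero_add, add_mul, sum_add_distrib]

theorem sum_antidiagonal_succ' (h : IsInvPoch q I) (f : ℕ → A) (s : ℕ) :
    (1 - q ^ (s + 1)) * ∑ p ∈ antidiagonal (s + 1), f p.1 * (I p.1 * I p.2)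
      = ∑ p ∈ antidiagonal s, (f p.1 + f (p.1 + 1) * q ^ p.2) * (I p.1 * I p.2) := by
  have key : ∀ p ∈ antidiagonal (s + 1), (1 - q ^ (s + 1)) * (f p.1 * (I p.1 * I p.2))
      = f p.1 * (I p.1 * ((1 - q ^ p.2) * I p.2))
        + f p.1 * q ^ p.2 * ((1 - q ^ p.1) * I p.1 * I p.2) := by
    intro p hp
    rw [← mem_antidiagonal.1 hp, pow_add]
    ring
  rw [mul_sum, sum_congr rfl key, sum_add_distrib, Nat.sum_antidiagonal_succ',
    Nat.sum_antidiagonal_succ]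
  simp only [← h.succ, pow_zero, sub_self, zero_mul, mul_zero, zero_add, add_mul, sum_add_distrib]

/-- A form of the `q`-Vandermonde summation. -/
theorem sum_vandermonde (h : IsInvPoch q I) (M d : ℕ) :
    ∑ p ∈ antidiagonal M, q ^ (p.1 * (p.1 + d)) * I (p.1 + d) * (I p.1 * I p.2)
      = I M * I (M + d) := by
  induction M generalizing d with
  | zero => simp [h.zero]
  -- The q-Pascal rule trades (M + 1, d) for (M, d + 1), hence the induction with `d` general.
  | succ M ih =>
    apply (h.isUnit_one_sub M).mul_left_cancel
    rw [h.sum_antidiagonal_succ fun r => q ^ (r * (r + d)) * I (r + d), ← mul_assoc, ← h.succ,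
      show M + 1 + d = M + (d + 1) by ring, ← ih]
    refine sum_congr rfl fun p _ => ?_
    rw [h.succ (p.1 + d), show p.1 + 1 + d = p.1 + d + 1 by ring,
      show p.1 + (d + 1) = p.1 + d + 1 by ring]
    ring

end IsInvPoch

/-- The coefficients `(-1) ^ j a ^ (j (j + 1) / 2) b ^ (j (j - 1) / 2)` of Ramanujan's theta
function `f(-a, -b)`. -/
def thetaCoeff (a b : A) : ℤ → A
  | Int.ofNat n => (-1) ^ n * a ^ (n + 1).choose 2 * b ^ n.choose 2
  | Int.negSucc n => (-1) ^ (n + 1) * a ^ (n + 1).choose 2 * b ^ (n + 2).choose 2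

theorem thetaCoeff_natCast (a b : A) (n : ℕ) :
    thetaCoeff a b n = (-1) ^ n * a ^ (n + 1).choose 2 * b ^ n.choose 2 := rfl

theorem thetaCoeff_neg_natCast (a b : A) (n : ℕ) :
    thetaCoeff a b (-n) = (-1) ^ n * a ^ n.choose 2 * b ^ (n + 1).choose 2 := by
  cases n with
  | zero => rfl
  | succ n => rfl

theorem choose_two_succ (n : ℕ) : (n + 1).choose 2 = n.choose 2 + n := by
  rw [Nat.choose_succ_succ' n 1, Nat.choose_one_right, add_comm]

/-- Consecutive coefficients have ratio -a(ab)^j; writing j = m - k avoids negative powers. -/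
theorem thetaCoeff_add_one_mul (a b : A) {j : ℤ} {k m : ℕ} (h : (m : ℤ) = k + j) :
    thetaCoeff a b (j + 1) * (a * b) ^ k = -(a * (a * b) ^ m) * thetaCoeff a b j := by
  obtain ⟨n, rfl | rfl⟩ := j.eq_nat_or_neg
  · obtain rfl : m = k + n := by omega
    rw [← Nat.cast_succ, thetaCoeff_natCast, thetaCoeff_natCast]
    simp only [Nat.succ_eq_add_one, choose_two_succ]
    ring
  · cases n with
    | zero =>
      obtain rfl : m = k := by omega
      have h1 := thetaCoeff_natCast a b 1
      have h0 := thetaCoeff_natCast a b 0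
      simp at h1 h0
      simp [h1, h0]
    | succ n =>
      obtain rfl : k = m + (n + 1) := by omega
      rw [show -((n + 1 : ℕ) : ℤ) + 1 = -(n : ℤ) by push_cast; ring, thetaCoeff_neg_natCast,
        thetaCoeff_neg_natCast]
      simp only [choose_two_succ]
      ring

theorem thetaCoeff_sub_one_mul (a b : A) {j : ℤ} {l n : ℕ} (h : (l : ℤ) = n + j) :
    thetaCoeff a b (j - 1) * (a * b) ^ l = -(b * (a * b) ^ n) * thetaCoeff a b j := by
  obtain ⟨i, rfl | rfl⟩ := j.eq_nat_or_neg
  · cases i with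
    | zero =>
      obtain rfl : l = n := by omega
      have h1 := thetaCoeff_neg_natCast a b 1
      have h0 := thetaCoeff_natCast a b 0
      simp at h1 h0
      simp [h1, h0]
    | succ i =>
      obtain rfl : l = n + (i + 1) := by omega
      rw [show ((i + 1 : ℕ) : ℤ) - 1 = (i : ℤ) by push_cast; ring, thetaCoeff_natCast,
        thetaCoeff_natCast]
      simp only [choose_two_succ]
      ring
  · obtain rfl : n = l + i := by omega
    rw [show -(i : ℤ) - 1 = -((i + 1 : ℕ) : ℤ) by push_cast; ring, thetaCoeff_neg_natCast,
      thetaCoeff_neg_natCast]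
    simp only [choose_two_succ]
    ring

/-- A finite form of the **Jacobi triple product** identity. -/
theorem IsInvPoch.sum_thetaCoeff_antidiagonal {a b : A} {I : ℕ → A} (h : IsInvPoch (a * b) I)
    (m n : ℕ) :
    ∑ p ∈ antidiagonal (m + n), thetaCoeff a b (m - p.1) * (I p.1 * I p.2)
      = I (m + n) * ((∏ i ∈ range m, (1 - a * (a * b) ^ i))
          * ∏ i ∈ range n, (1 - b * (a * b) ^ i)) := by
  induction n with
  | zero =>
    induction m with
    | zero => simp [h.zero, thetaCoeff]
    | succ m ih =>
      apply (h.isUnit_one_sub m).mul_left_cancel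
      rw [add_zero, h.sum_antidiagonal_succ fun k => thetaCoeff a b ((m + 1 : ℕ) - k),
        ← mul_assoc, ← h.succ, prod_range_succ]
      simp only [add_zero, prod_range_zero, mul_one] at ih ⊢
      rw [← mul_assoc, ← ih, sum_mul]
      refine sum_congr rfl fun p _ => ?_
      have := thetaCoeff_add_one_mul a b (j := m - p.1) (k := p.1) (m := m) (by ring)
      push_cast
      rw [show (m : ℤ) + 1 - p.1 = m - p.1 + 1 by ring, this,
        show (m : ℤ) + 1 - (p.1 + 1) = m - p.1 by ring]
      ring
  | succ n ih =>
    apply (h.isUnit_one_sub (m + n)).mul_left_cancel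
    rw [← add_assoc, h.sum_antidiagonal_succ' fun k => thetaCoeff a b (m - k),
        ← mul_assoc, ← h.succ, prod_range_succ, ← mul_assoc, ← mul_assoc, mul_assoc (I (m + n)),
        ← ih, sum_mul]
    refine sum_congr rfl fun p hp => ?_
    have hp := Finset.HasAntidiagonal.mem_antidiagonal.1 hp
    have := thetaCoeff_sub_one_mul a b (j := m - p.1) (l := p.2) (n := n) (by omega)
    push_cast
    rw [show (m : ℤ) - (p.1 + 1) = m - p.1 - 1 by ring, this]
    ring

/-- The sum of the coefficients of `f(-a, -b)` of index `j` and `-j`. -/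
def thetaPair (a b : A) : ℕ → A
  | 0 => 1
  | j + 1 => thetaCoeff a b (j + 1 : ℕ) + thetaCoeff a b (-(j + 1 : ℕ))

theorem IsInvPoch.sum_thetaPair {a b : A} {I : ℕ → A} (h : IsInvPoch (a * b) I) (N : ℕ) :
    ∑ j ∈ range (N + 1), thetaPair a b j * (I (N - j) * I (N + j))
      = I (N + N) * ∏ i ∈ range N, ((1 - a * (a * b) ^ i) * (1 - b * (a * b) ^ i)) := by
  rw [prod_mul_distrib, ← h.sum_thetaCoeff_antidiagonal,
    Nat.sum_antidiagonal_eq_sum_range_succ (fun k l => thetaCoeff a b (N - k) * (I k * I l)),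
    Nat.succ_eq_add_one, show N + N + 1 = N + (N + 1) by ring,
    sum_range_succ' _ N, sum_range_add, sum_range_succ' _ N,
    ← sum_range_reflect (fun k : ℕ => thetaCoeff a b (N - k) * (I k * I (N + N - k))) N, ← add_assoc,
    ← sum_add_distrib]
  congr 1
  · refine sum_congr rfl fun j hj => ?_
    rw [mem_range] at hj
    rw [thetaPair, show N + N - (N - 1 - j) = N + (j + 1) by omega,
      show N - 1 - j = N - (j + 1) by omega, show N + N - (N + (j + 1)) = N - (j + 1) by omega,
      show (N : ℤ) - (N - (j + 1) : ℕ) = (j + 1 : ℕ) by omega,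
      show (N : ℤ) - (N + (j + 1) : ℕ) = -(j + 1 : ℕ) by omega]
    ring
  · simp [thetaPair, thetaCoeff]

/-- **Bailey's lemma** in the limiting case `ρ₁, ρ₂ → ∞`, relative to `1`. -/
theorem IsInvPoch.bailey {q : A} {I : ℕ → A} (h : IsInvPoch q I) (α : ℕ → A) (N : ℕ) :
    ∑ s ∈ range (N + 1), q ^ (s ^ 2) * I (N - s)
        * ∑ j ∈ range (s + 1), α j * (I (s - j) * I (s + j))
      = ∑ j ∈ range (N + 1), q ^ (j ^ 2) * α j * (I (N - j) * I (N + j)) := by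
  simp_rw [mul_sum]
  rw [sum_comm' (t' := range (N + 1)) (s' := fun j => Ico j (N + 1))
    (by intro s j; simp only [mem_range, mem_Ico]; omega)]
  refine sum_congr rfl fun j hj => ?_
  rw [mem_range] at hj
  -- After exchanging sums, the inner sum is q-Vandermonde with M = N - j and d = 2j.
  rw [sum_Ico_eq_sum_range, show N + 1 - j = N - j + 1 by omega,
    show N + j = N - j + 2 * j by omega, ← h.sum_vandermonde, mul_sum,
    Nat.sum_antidiagonal_eq_sum_range_succ
      (fun r u => q ^ j ^ 2 * α j * (q ^ (r * (r + 2 * j)) * I (r + 2 * j) * (I r * I u)))]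
  refine sum_congr rfl fun r _ => ?_
  rw [show N - (j + r) = N - j - r by omega, show j + r - j = r by omega,
    show j + r + j = r + 2 * j by omega]
  ring

/-- Two applications of Bailey's lemma to the unit Bailey pair. -/
theorem IsInvPoch.sum_rogersRamanujan {q : A} {I : ℕ → A} (h : IsInvPoch q I) (N : ℕ) :
    ∑ s ∈ range (N + 1), q ^ (s ^ 2) * I (N - s) * I s
      = ∑ j ∈ range (N + 1), thetaPair (q ^ 2) (q ^ 3) j * (I (N - j) * I (N + j)) := by
  have h' : IsInvPoch (1 * q) I := by rwa [one_mul]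
  have h0 : ∀ r, ∑ j ∈ range (r + 1), thetaPair 1 q j * (I (r - j) * I (r + j))
      = if r = 0 then 1 else 0 := by
    intro r
    -- With a = 1 the product has the factor 1 - a = 0 as soon as r > 0: this is the unit Bailey
    -- pair.
    rw [h'.sum_thetaPair]
    cases r with
    | zero => simp [h.zero]
    | succ r => simp [prod_range_succ']
  have h1 := h.bailey (fun j => q ^ (j ^ 2) * thetaPair 1 q j) N
  have hθ : ∀ j, q ^ (j ^ 2) * (q ^ (j ^ 2) * thetaPair 1 q j) = thetaPair (q ^ 2) (q ^ 3) j := by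
    intro j
    cases j with
    | zero => simp [thetaPair]
    | succ j =>
      rw [thetaPair, thetaPair, thetaCoeff_natCast, thetaCoeff_natCast, thetaCoeff_neg_natCast,
        thetaCoeff_neg_natCast, choose_two_succ (j + 1)]
      have e : (j + 1) ^ 2 = 2 * (j + 1).choose 2 + (j + 1) := by
        induction j with
        | zero => rfl
        | succ j ih => rw [choose_two_succ (j + 1)]; nlinarith
      rw [e]
      ring
  simp_rw [hθ, ← h.bailey, h0] at h1
  rw [← h1]
  refine sum_congr rfl fun s _ => ?_
  congr 1
  rw [sum_eq_single 0] <;> simp +contextual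

end Finite

/-! ### Rogers–Ramanujan for nilpotent q -/

section Nilpotent

open Finset

variable {A : Type*} [CommRing A]

/-- Replaces the limit of 1/(q;q)_n: the extra factors 1 - q^k act as 1 on `y`. -/
theorem IsInvPoch.mul_eq_mul_of_le {q y : A} {I : ℕ → A} (h : IsInvPoch q I) {m n : ℕ}
    (hmn : m ≤ n) (hy : ∀ k, m < k → y * q ^ k = 0) : y * I m = y * I n := by
  induction n, hmn using Nat.le_induction with
  | base => rfl
  | succ n hn ih =>
    rw [ih, h.succ n]
    linear_combination (-I (n + 1)) * hy (n + 1) (by omega)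

/-- Sorts the factors by residue mod 5: class 0, classes 2 and 3 (the theta product), classes 1 and
4. -/
theorem qPoch_five_mul (q : A) (N : ℕ) :
    qPoch q (5 * N) = qPoch (q ^ 5) N
      * (∏ i ∈ range N, ((1 - q ^ 2 * (q ^ 2 * q ^ 3) ^ i) * (1 - q ^ 3 * (q ^ 2 * q ^ 3) ^ i)))
      * ∏ k ∈ range N, ((1 - q ^ (5 * k + 1)) * (1 - q ^ (5 * k + 4))) := by
  induction N with
  | zero => simp [qPoch]
  | succ N ih =>
    rw [show 5 * (N + 1) = 5 * N + 1 + 1 + 1 + 1 + 1 by ring]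
    simp only [qPoch_succ, prod_range_succ, ih]
    ring

theorem pow_dvd_thetaPair (q : A) (j : ℕ) : q ^ j ∣ thetaPair (q ^ 2) (q ^ 3) j := by
  cases j with
  | zero => simp
  | succ j =>
    rw [thetaPair, thetaCoeff_natCast, thetaCoeff_neg_natCast, choose_two_succ (j + 1)]
    refine dvd_add (Dvd.dvd.mul_right (Dvd.dvd.mul_left ?_ _) _) (Dvd.dvd.mul_left ?_ _)
    all_goals rw [← pow_mul]; exact pow_dvd_pow _ (by omega)

/-- The first Rogers–Ramanujan identity modulo `q ^ (N + 1)`. -/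
theorem rogersRamanujan_of_pow_eq_zero {q : A} {N : ℕ} (hq : q ^ (N + 1) = 0) {I J : ℕ → A}
    (hI : IsInvPoch q I) (hJ : IsInvPoch (q ^ 5) J) :
    (∑ s ∈ range (N + 1), q ^ (s ^ 2) * I s)
      * ∏ k ∈ range N, ((1 - q ^ (5 * k + 1)) * (1 - q ^ (5 * k + 4))) = 1 := by
  have hq0 : ∀ n, N < n → q ^ n = 0 := fun n hn => pow_eq_zero_of_le hn hq
  have hJ' : IsInvPoch (q ^ 2 * q ^ 3) J := by rwa [← pow_add]
  have hθ : ∀ K : ℕ → A, (∃ e, 0 < e ∧ IsInvPoch (q ^ e) K) →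
      ∑ j ∈ range (N + 1), thetaPair (q ^ 2) (q ^ 3) j * (K (N - j) * K (N + j))
        = K N * K N * ∑ j ∈ range (N + 1), thetaPair (q ^ 2) (q ^ 3) j := by
    rintro K ⟨e, he, hK⟩
    rw [mul_sum]
    refine sum_congr rfl fun j hj => ?_
    rw [mem_range] at hj
    have h1 : 1 * K N = 1 * K (N + j) := hK.mul_eq_mul_of_le (by omega) fun k hk => by
      rw [one_mul, ← pow_mul]
      exact hq0 _ (by nlinarith)
    have h2 : q ^ j * K (N - j) = q ^ j * K N := hK.mul_eq_mul_of_le (by omega) fun k hk => by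
      rw [← pow_mul, ← pow_add]
      refine hq0 _ ?_
      have : 1 * k ≤ e * k := Nat.mul_le_mul_right k he
      omega
    obtain ⟨c, hc⟩ := pow_dvd_thetaPair q j
    rw [one_mul, one_mul] at h1
    rw [hc, ← h1]
    linear_combination c * K N * h2
  have hS : ∑ s ∈ range (N + 1), q ^ (s ^ 2) * I (N - s) * I s
      = I N * ∑ s ∈ range (N + 1), q ^ (s ^ 2) * I s := by
    rw [mul_sum]
    refine sum_congr rfl fun s hs => ?_
    rw [mem_range] at hs
    have h2 : q ^ (s ^ 2) * I (N - s) = q ^ (s ^ 2) * I N :=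
      hI.mul_eq_mul_of_le (by omega) fun k hk => by
        rw [← pow_add]
        refine hq0 _ ?_
        have : s ≤ s ^ 2 := Nat.le_self_pow two_ne_zero s
        omega
    linear_combination I s * h2
  have e1 := hI.sum_rogersRamanujan N
  rw [hS, hθ I ⟨1, one_pos, by rwa [pow_one]⟩] at e1
  have e2 := hJ'.sum_thetaPair N
  rw [hθ J ⟨5, by norm_num, hJ⟩] at e2
  have hconst : ∀ {e : ℕ} {K : ℕ → A}, 0 < e → IsInvPoch (q ^ e) K → ∀ n, N ≤ n → K n = K N := by
    intro e K he hK n hn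
    have h1 : 1 * K N = 1 * K n := hK.mul_eq_mul_of_le hn fun k hk => by
      rw [one_mul, ← pow_mul]
      exact hq0 _ (by nlinarith)
    rw [← one_mul (K n), ← h1, one_mul]
  rw [hconst (by norm_num) hJ (N + N) (by omega)] at e2
  have e3 := hI (5 * N)
  have hI1 : IsInvPoch (q ^ 1) I := by rwa [pow_one]
  rw [hconst one_pos hI1 (5 * N) (by omega), qPoch_five_mul] at e3
  have uI := hI N
  have uJ := hJ N
  set Θ := ∑ j ∈ range (N + 1), thetaPair (q ^ 2) (q ^ 3) j
  have e1' : ∑ s ∈ range (N + 1), q ^ (s ^ 2) * I s = I N * Θ := by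
    apply (IsUnit.of_mul_eq_one_right _ uI).mul_left_cancel
    rw [e1]; ring
  -- As J (2N) = J N, the triple product reads J N * J N * Θ = J N * ∏.
  have e2' : Θ = qPoch (q ^ 5) N * ∏ i ∈ range N,
      ((1 - q ^ 2 * (q ^ 2 * q ^ 3) ^ i) * (1 - q ^ 3 * (q ^ 2 * q ^ 3) ^ i)) := by
    apply (IsUnit.of_mul_eq_one_right _ uJ).mul_left_cancel
    apply (IsUnit.of_mul_eq_one_right _ uJ).mul_left_cancel
    rw [← mul_assoc, e2, ← mul_assoc (J N) (qPoch _ _), mul_comm (J N) (qPoch _ _), uJ, one_mul]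
  rw [e1', e2']
  linear_combination e3

end Nilpotent

/-! ### Transfer to power series through the quotient by X^(N+1) -/

section PowerSeries

open Finset PowerSeries

variable {R : Type*} [CommRing R]

theorem isUnit_of_constantCoeff_eq_one {f : R⟦X⟧} (hf : constantCoeff f = 1) : IsUnit f := by
  rw [isUnit_iff_constantCoeff, hf]
  exact isUnit_one

theorem exists_isInvPoch_X_pow {e : ℕ} (he : e ≠ 0) :
    ∃ I : ℕ → R⟦X⟧, IsInvPoch (X ^ e) I := by
  refine ⟨fun n => Ring.inverse (qPoch (X ^ e) n), fun n => Ring.mul_inverse_cancel _ ?_⟩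
  apply isUnit_of_constantCoeff_eq_one
  simp [qPoch, he]

/-- The first Rogers–Ramanujan identity for power series, modulo `X ^ (N + 1)`. -/
theorem X_pow_dvd_rogersRamanujan {I : ℕ → R⟦X⟧} (hI : IsInvPoch X I) (N : ℕ) :
    X ^ (N + 1) ∣ (∑ s ∈ range (N + 1), X ^ (s ^ 2) * I s)
      * ∏ k ∈ range N, ((1 - X ^ (5 * k + 1)) * (1 - X ^ (5 * k + 4))) - (1 : R⟦X⟧) := by
  obtain ⟨J, hJ⟩ := exists_isInvPoch_X_pow (R := R) (e := 5) (by norm_num)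
  let φ := Ideal.Quotient.mk (Ideal.span {(X : R⟦X⟧) ^ (N + 1)})
  have hφ : ∀ {q : R⟦X⟧} {K : ℕ → R⟦X⟧}, IsInvPoch q K → IsInvPoch (φ q) fun n => φ (K n) := by
    intro q K hK n
    have := congrArg φ (hK n)
    simpa [qPoch] using this
  have hX : φ X ^ (N + 1) = 0 := by
    rw [← map_pow]
    exact Ideal.Quotient.eq_zero_iff_mem.2 (Ideal.mem_span_singleton_self _)
  have hJ' := hφ hJ
  rw [map_pow] at hJ'
  have key := rogersRamanujan_of_pow_eq_zero hX (hφ hI) hJ'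
  rw [← Ideal.mem_span_singleton, ← Ideal.Quotient.eq]
  change φ _ = φ _
  simpa using key

end PowerSeries

/-! ### Removing the weights -/

section Weights

open Finset PowerSeries

variable {R : Type*} [CommRing R]

/-- The product of the four factors that carry a weight. -/
noncomputable def weightedFactors (t w v x : R) : R⟦X⟧ :=
  (1 - C t * X) * (1 - C w * X ^ 4) * (1 - C v * X ^ 6) * (1 - C x * X ^ 9)

theorem isUnit_weightedFactors (t w v x : R) : IsUnit (weightedFactors t w v x) :=
  isUnit_of_constantCoeff_eq_one (by simp [weightedFactors])

theorem weight_of_ten_le (t w v x : R) {n : ℕ} (hn : 10 ≤ n) : weight t w v x n = 1 := by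
  obtain ⟨m, rfl⟩ := Nat.exists_eq_add_of_le' hn
  rfl

theorem factor_of_ten_le (t w v x : R) {n : ℕ} (hn : 10 ≤ n) :
    factor t w v x n = 1 - X ^ n := by
  rw [factor, weight_of_ten_le t w v x hn, map_one, one_mul]

theorem weightedFactors_mul_qPoch (t w v x : R) {m : ℕ} (hm : 9 ≤ m) :
    weightedFactors t w v x * qPoch X m
      = weightedFactors 1 1 1 1 * ∏ i ∈ Icc 1 m, factor t w v x i := by
  induction m, hm using Nat.le_induction with
  | base =>
    simp only [qPoch, weightedFactors, factor, weight, prod_range_succ, prod_range_zero,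
      prod_Icc_succ_top, Icc_self, prod_singleton, Nat.reduceAdd, Nat.reduceLeDiff, map_one,
      one_mul, pow_one, zero_add]
    ring
  | succ m hm ih =>
    rw [qPoch_succ, Finset.prod_Icc_succ_top (by omega), factor_of_ten_le _ _ _ _ (by omega),
      ← mul_assoc, ← mul_assoc, ih]

theorem weightedFactors_mul_prod_pairFactor (t w v x : R) {N : ℕ} (hN : 2 ≤ N) :
    weightedFactors 1 1 1 1 * ∏ k ∈ range N, pairFactor t w v x k
      = weightedFactors t w v x
        * ∏ k ∈ range N, ((1 - X ^ (5 * k + 1)) * (1 - X ^ (5 * k + 4))) := by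
  induction N, hN using Nat.le_induction with
  | base =>
    simp [prod_range_succ, pairFactor, factor, weight, weightedFactors]
    ring
  | succ N hN ih =>
    rw [prod_range_succ, prod_range_succ, pairFactor, factor_of_ten_le _ _ _ _ (by omega),
      factor_of_ten_le _ _ _ _ (by omega), ← mul_assoc, ih, mul_assoc]

theorem weightedFactors_mul_tailTerm (t w v x : R) {I : ℕ → R⟦X⟧} (hI : IsInvPoch X I) {m : ℕ}
    (hm : 9 ≤ m) :
    weightedFactors t w v x * tailTerm t w v x m
      = weightedFactors 1 1 1 1 * (X ^ (m ^ 2) * I m) := by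
  have h1 : tailTerm t w v x m * ∏ i ∈ Icc 1 m, factor t w v x i = X ^ (m ^ 2) := by
    refine frac_mul_cancel _ _ ?_
    rw [map_prod]
    exact prod_eq_one fun i hi => constantCoeff_factor t w v x i (by
      have := (mem_Icc.1 hi).1
      omega)
  have h2 := weightedFactors_mul_qPoch t w v x hm
  have h3 := hI m
  linear_combination (-(weightedFactors t w v x * tailTerm t w v x m)) * h3
    + tailTerm t w v x m * I m * h2 + weightedFactors 1 1 1 1 * I m * h1

/-- The terms `m = 0, …, 4` of the sum side, with denominators cleared. -/
theorem head_identity {A : Type*} [CommRing A] {q t w v x : A} {I f : ℕ → A}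
    (hI : IsInvPoch q I)
    (h1 : f 1 * (1 - t * q) = t)
    (h2 : f 2 * ((1 - t * q) * (1 - w * q ^ 4)) = w + v * q ^ 2)
    (h3 : f 3 * ((1 - t * q) * (1 - w * q ^ 4) * (1 - v * q ^ 6))
      = x + q ^ 2 + v ^ 2 * q ^ 3 + q ^ 5)
    (h4 : f 4 * ((1 - t * q) * (1 - w * q ^ 4) * (1 - v * q ^ 6) * (1 - x * q ^ 9))
      = 1 + x ^ 2 * q ^ 2 + q ^ 3 + x * q ^ 4 + q ^ 5 + q ^ 6 + x * q ^ 7 + q ^ 8 + q ^ 10) :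
    (1 - t * q) * (1 - w * q ^ 4) * (1 - v * q ^ 6) * (1 - x * q ^ 9)
        * (1 + q * f 1 + q ^ 4 * f 2 + q ^ 9 * f 3 + q ^ 16 * f 4)
      = (1 - q) * (1 - q ^ 4) * (1 - q ^ 6) * (1 - q ^ 9)
        * ∑ m ∈ range 5, q ^ (m ^ 2) * I m := by
  have i0 := hI.zero
  have i1 := hI 1
  have i2 := hI 2
  have i3 := hI 3
  have i4 := hI 4
  simp only [qPoch, prod_range_succ, prod_range_zero, zero_add, Nat.reduceAdd, one_mul,
    pow_one] at i1 i2 i3 i4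
  have k1 : (1 - q) * (1 - q ^ 4) * (1 - q ^ 6) * (1 - q ^ 9) * I 1
      = (1 - q ^ 4) * (1 - q ^ 6) * (1 - q ^ 9) := by
    linear_combination (1 - q ^ 4) * (1 - q ^ 6) * (1 - q ^ 9) * i1
  have k2 : (1 - q) * (1 - q ^ 4) * (1 - q ^ 6) * (1 - q ^ 9) * I 2
      = (1 + q ^ 2) * (1 - q ^ 6) * (1 - q ^ 9) := by
    linear_combination (1 + q ^ 2) * (1 - q ^ 6) * (1 - q ^ 9) * i2
  have k3 : (1 - q) * (1 - q ^ 4) * (1 - q ^ 6) * (1 - q ^ 9) * I 3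
      = (1 + q ^ 2) * (1 + q ^ 3) * (1 - q ^ 9) := by
    linear_combination (1 + q ^ 2) * (1 + q ^ 3) * (1 - q ^ 9) * i3
  have k4 : (1 - q) * (1 - q ^ 4) * (1 - q ^ 6) * (1 - q ^ 9) * I 4
      = (1 + q ^ 2 + q ^ 4) * (1 + q ^ 3 + q ^ 6) := by
    linear_combination (1 + q ^ 2 + q ^ 4) * (1 + q ^ 3 + q ^ 6) * i4
  simp only [sum_range_succ, sum_range_zero, i0]
  -- Over their successive denominators, the partial sums have numerators 1, 1 + vq^6, 1 + xq^9 +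
  -- q^11 + q^14, and then one free of weights: each new factor cancels the weights left over.
  linear_combination q * (1 - w * q ^ 4) * (1 - v * q ^ 6) * (1 - x * q ^ 9) * h1
    + q ^ 4 * (1 - v * q ^ 6) * (1 - x * q ^ 9) * h2 + q ^ 9 * (1 - x * q ^ 9) * h3
    + q ^ 16 * h4 - q * k1 - q ^ 4 * k2 - q ^ 9 * k3 - q ^ 16 * k4

theorem weightedFactors_mul_headSum (t w v x : R) {I : ℕ → R⟦X⟧} (hI : IsInvPoch X I) :
    weightedFactors t w v x * headSum X (C t) (C w) (C v) (C x)
      = weightedFactors 1 1 1 1 * ∑ m ∈ range 9, X ^ (m ^ 2) * I m := by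
  have hB : weightedFactors 1 1 1 1 * I 4 = commonNum (X : R⟦X⟧) := by
    have h4 := hI 4
    simp only [qPoch, prod_range_succ, prod_range_zero, zero_add, Nat.reduceAdd, one_mul,
      pow_one] at h4
    simp only [weightedFactors, commonNum, map_one, one_mul]
    -- B(q) factors as (1-q^6)(1-q^9) / ((1-q^2)(1-q^3)).
    linear_combination (1 + X ^ 2 + X ^ 4) * (1 + X ^ 3 + X ^ 6) * h4
  have u : ∀ n : ℕ, IsUnit (1 - X ^ (n + 1) : R⟦X⟧) := hI.isUnit_one_sub
  have i5 := hI.succ 4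
  have i6 := hI.succ 5
  have i7 := hI.succ 6
  have i8 := hI.succ 7
  have h5 : weightedFactors t w v x * frac (commonNum X) (weightedFactors t w v x * (1 - X ^ 5))
      = weightedFactors 1 1 1 1 * I 5 := by
    have := frac_mul_cancel (commonNum X) (weightedFactors t w v x * (1 - X ^ 5))
      (by simp [weightedFactors])
    apply (u 4).mul_left_cancel
    linear_combination this - hB + weightedFactors 1 1 1 1 * i5
  have h6 : weightedFactors t w v x
      * frac (commonNum X) (weightedFactors t w v x * (1 - X ^ 5) * (1 - X ^ 6))
      = weightedFactors 1 1 1 1 * I 6 := by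
    have := frac_mul_cancel (commonNum X) (weightedFactors t w v x * (1 - X ^ 5) * (1 - X ^ 6))
      (by simp [weightedFactors])
    apply ((u 4).mul (u 5)).mul_left_cancel
    linear_combination this - hB + weightedFactors 1 1 1 1 * (i5 + (1 - X ^ 5) * i6)
  have h7 : weightedFactors t w v x
      * frac (commonNum X) (weightedFactors t w v x * (1 - X ^ 5) * (1 - X ^ 6) * (1 - X ^ 7))
      = weightedFactors 1 1 1 1 * I 7 := by
    have := frac_mul_cancel (commonNum X)
      (weightedFactors t w v x * (1 - X ^ 5) * (1 - X ^ 6) * (1 - X ^ 7))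
      (by simp [weightedFactors])
    apply (((u 4).mul (u 5)).mul (u 6)).mul_left_cancel
    linear_combination this - hB
      + weightedFactors 1 1 1 1 * (i5 + (1 - X ^ 5) * (i6 + (1 - X ^ 6) * i7))
  have h8 : weightedFactors t w v x * frac (commonNum X)
        (weightedFactors t w v x * (1 - X ^ 5) * (1 - X ^ 6) * (1 - X ^ 7) * (1 - X ^ 8))
      = weightedFactors 1 1 1 1 * I 8 := by
    have := frac_mul_cancel (commonNum X)
      (weightedFactors t w v x * (1 - X ^ 5) * (1 - X ^ 6) * (1 - X ^ 7) * (1 - X ^ 8))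
      (by simp [weightedFactors])
    apply ((((u 4).mul (u 5)).mul (u 6)).mul (u 7)).mul_left_cancel
    linear_combination this - hB + weightedFactors 1 1 1 1
      * (i5 + (1 - X ^ 5) * (i6 + (1 - X ^ 6) * (i7 + (1 - X ^ 7) * i8)))
  let f : ℕ → R⟦X⟧
    | 1 => frac (C t) (1 - C t * X)
    | 2 => frac (C w + C v * X ^ 2) ((1 - C t * X) * (1 - C w * X ^ 4))
    | 3 => frac (C x + X ^ 2 + C v ^ 2 * X ^ 3 + X ^ 5)
        ((1 - C t * X) * (1 - C w * X ^ 4) * (1 - C v * X ^ 6))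
    | _ => frac (1 + C x ^ 2 * X ^ 2 + X ^ 3 + C x * X ^ 4 + X ^ 5 + X ^ 6 + C x * X ^ 7 + X ^ 8
        + X ^ 10) (weightedFactors t w v x)
  have h := head_identity (f := f) hI (frac_mul_cancel _ _ (by simp))
    (frac_mul_cancel _ _ (by simp)) (frac_mul_cancel _ _ (by simp))
    (frac_mul_cancel _ _ (by simp [weightedFactors]))
  have hD : ∀ S : R⟦X⟧, (1 - X) * (1 - X ^ 4) * (1 - X ^ 6) * (1 - X ^ 9) * S
      = weightedFactors 1 1 1 1 * S := by simp [weightedFactors]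
  rw [hD] at h
  change weightedFactors t w v x * _ = _ at h
  have hs : headSum X (C t) (C w) (C v) (C x)
      = 1 + X * f 1 + X ^ 4 * f 2 + X ^ 9 * f 3 + X ^ 16 * f 4
        + X ^ 25 * frac (commonNum X) (weightedFactors t w v x * (1 - X ^ 5))
        + X ^ 36 * frac (commonNum X) (weightedFactors t w v x * (1 - X ^ 5) * (1 - X ^ 6))
        + X ^ 49 * frac (commonNum X)
          (weightedFactors t w v x * (1 - X ^ 5) * (1 - X ^ 6) * (1 - X ^ 7))
        + X ^ 64 * frac (commonNum X)
          (weightedFactors t w v x * (1 - X ^ 5) * (1 - X ^ 6) * (1 - X ^ 7) * (1 - X ^ 8)) := rfl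
  rw [hs, sum_range_succ, sum_range_succ, sum_range_succ, sum_range_succ]
  linear_combination h + X ^ 25 * h5 + X ^ 36 * h6 + X ^ 49 * h7 + X ^ 64 * h8

end Weights

/-! ### Convergence and passage to the limit -/

section Limit

open Finset PowerSeries Filter Topology

variable {R : Type*} [CommRing R] [TopologicalSpace R]

theorem summable_tailTerm (t w v x : R) : Summable fun m : ℕ => tailTerm t w v x (m + 9) := by
  nontriviality R
  apply WithPiTopology.summable_of_tendsto_order_atTop_nhds_top
  refine ENat.tendsto_nhds_top_iff_natCast_lt.mpr fun n => eventually_atTop.mpr ⟨n, fun m hm => ?_⟩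
  refine lt_of_lt_of_le ?_
    (nat_le_order _ _ (X_pow_dvd_iff.1 (dvd_mul_right (X ^ ((m + 9) ^ 2)) _)))
  norm_cast
  nlinarith

theorem multipliable_pairFactor (t w v x : R) : Multipliable fun k : ℕ => pairFactor t w v x k := by
  nontriviality R
  suffices h : Multipliable fun k => 1 + (pairFactor t w v x k - 1) by simpa using h
  apply WithPiTopology.multipliable_one_add_of_tendsto_order_atTop_nhds_top
  refine ENat.tendsto_nhds_top_iff_natCast_lt.mpr fun n => eventually_atTop.mpr ⟨n, fun k hk => ?_⟩
  have hd : (X : R⟦X⟧) ^ (5 * k + 1) ∣ pairFactor t w v x k - 1 := by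
    refine ⟨-C (weight t w v x (5 * k + 1)) - C (weight t w v x (5 * k + 4)) * X ^ 3
      + C (weight t w v x (5 * k + 1)) * C (weight t w v x (5 * k + 4)) * X ^ (5 * k + 4), ?_⟩
    rw [pairFactor, factor, factor]
    ring
  refine lt_of_lt_of_le ?_ (nat_le_order _ _ (X_pow_dvd_iff.1 hd))
  norm_cast
  omega

theorem headSum_add_tsum_mul_tprod [DiscreteTopology R] (t w v x : R) :
    (headSum X (C t) (C w) (C v) (C x) + ∑' m : ℕ, tailTerm t w v x (m + 9))
      * ∏' k : ℕ, pairFactor t w v x k = 1 := by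
  obtain ⟨I, hI⟩ := exists_isInvPoch_X_pow (R := R) one_ne_zero
  rw [pow_one] at hI
  have h1 := (summable_tailTerm t w v x).hasSum.tendsto_sum_nat
  -- The shift aligns truncations: N tail terms after the 9 head terms reach m = N + 8.
  have h2 := (tendsto_add_atTop_iff_nat 8).2
    (multipliable_pairFactor t w v x).hasProd.tendsto_prod_nat
  have h3 := (h1.const_add (headSum X (C t) (C w) (C v) (C x))).mul h2
  refine tendsto_nhds_unique h3 ?_
  rw [WithPiTopology.tendsto_iff_coeff_tendsto]
  refine fun d => tendsto_nhds_of_eventually_eq (eventually_atTop.mpr ⟨d, fun N hN => ?_⟩)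
  have hL : weightedFactors t w v x * (headSum X (C t) (C w) (C v) (C x)
      + ∑ m ∈ range N, tailTerm t w v x (m + 9))
      = weightedFactors 1 1 1 1 * ∑ m ∈ range (N + 8 + 1), X ^ (m ^ 2) * I m := by
    rw [mul_add, weightedFactors_mul_headSum t w v x hI, mul_sum (range N),
      sum_congr rfl fun m _ => weightedFactors_mul_tailTerm t w v x hI (Nat.le_add_left 9 m),
      ← mul_sum, ← mul_add, show N + 8 + 1 = 9 + N by ring, sum_range_add]
    simp only [add_comm 9]
  have hR := weightedFactors_mul_prod_pairFactor t w v x (N := N + 8) (by omega)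
  have hprod : (headSum X (C t) (C w) (C v) (C x) + ∑ m ∈ range N, tailTerm t w v x (m + 9))
      * ∏ k ∈ range (N + 8), pairFactor t w v x k
      = (∑ m ∈ range (N + 8 + 1), X ^ (m ^ 2) * I m)
        * ∏ k ∈ range (N + 8), ((1 - X ^ (5 * k + 1)) * (1 - X ^ (5 * k + 4))) := by
    -- One weighted product clears the sum, the all-ones one clears the product.
    apply (isUnit_weightedFactors t w v x).mul_left_cancel
    apply (isUnit_weightedFactors (1 : R) 1 1 1).mul_left_cancel
    rw [← mul_assoc (weightedFactors t w v x), hL]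
    linear_combination weightedFactors 1 1 1 1
      * (∑ m ∈ range (N + 8 + 1), X ^ (m ^ 2) * I m) * hR
  have := X_pow_dvd_iff.1 (X_pow_dvd_rogersRamanujan hI (N + 8)) d (by omega)
  rw [← hprod, map_sub, sub_eq_zero] at this
  exact this

end Limit

end WeightedRR

theorem mainTheorem2 {R : Type*} [CommRing R] [TopologicalSpace R] [DiscreteTopology R]
    (t w v x : R) :
    (Summable fun m : ℕ => WeightedRR.tailTerm t w v x (m + 9)) ∧
    (Multipliable fun k : ℕ => WeightedRR.pairFactor t w v x k) ∧
    IsUnit (∏' k : ℕ, WeightedRR.pairFactor t w v x k) ∧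
    WeightedRR.headSum PowerSeries.X (PowerSeries.C t) (PowerSeries.C w) (PowerSeries.C v)
        (PowerSeries.C x)
      + ∑' m : ℕ, WeightedRR.tailTerm t w v x (m + 9)
      = WeightedRR.frac 1 (∏' k : ℕ, WeightedRR.pairFactor t w v x k) := by
  have h := WeightedRR.headSum_add_tsum_mul_tprod t w v x
  have hu := IsUnit.of_mul_eq_one_right _ h
  refine ⟨WeightedRR.summable_tailTerm t w v x, WeightedRR.multipliable_pairFactor t w v x, hu, ?_⟩
  rw [WeightedRR.frac]
  exact (Ring.eq_mul_inverse_iff_mul_eq _ _ _ hu).2 h
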